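/- Theorem (Regularity bounds for DNNs). Let $s=d_0,d_1,\dots,d_{L+1}$ be nonnegative integers (the widths), and for $0\le\ell\le L$ let $W_\ell\in\mathbb{R}^{d_{\ell+1}\times d_\ell}$ and $\boldsymbol v_\ell\in\mathbb{R}^{d_{\ell+1}}$. Let $\sigma:\mathbb{R}\to\mathbb{R}$ be smooth ($C^\infty$), applied componentwise to vectors. Define, for $\boldsymbol y\in\mathbb{R}^s$, (a) the non-periodic DNN by $G^{[0]}(\boldsymbol y):=W_0\,\boldsymbol y+\boldsymbol v_0$ and $G^{[\ell]}(\boldsymbol y):=W_\ell\,\sigma(G^{[\ell-1]}(\boldsymbol y))+\boldsymbol v_\ell$ for $1\le\ell\le L$; (b) the periodic DNN by $G^{[0]}(\boldsymbol y):=W_0\sin(2\pi\boldsymbol y)+\boldsymbol v_0$ (sine applied componentwise) and $G^{[\ell]}(\boldsymbol y):=W_\ell\,\sigma(G^{[\ell-1]}(\boldsymbol y))+\boldsymbol v_\ell$ for $1\le\ell\le L$. Let $(\beta_j)_{j\ge1}$, $(R_\ell)_{\ell\ge1}$, $(A_n)_{n\ge1}$ be sequences of positive real numbers such that $$\max_{1\le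 p\le d_1}|W_{0,p,j}|\le\beta_j\ \ (1\le j\le s),\qquad \max_{1\le p\le d_{\ell+1}}\sum_{q=1}^{d_\ell}|W_{\ell,p,q}|\le R_\ell\ \ (1\le\ell\le L),\qquad \sup_{x\in\mathbb{R}}|\sigma^{(n)}(x)|\le A_n\ \ (n\ge1),$$ where a maximum over an empty set is read as $0$. Define $\Gamma^{[\ell]}_n$ and $\mathbb{B}^{[\ell]}_{n,\lambda}$ recursively by $$\Gamma^{[1]}_n:=A_n\ (n\ge1),\qquad \Gamma^{[\ell]}_n:=\sum_{\lambda=1}^nA_\lambda\,R_{\ell-1}^\lambda\,\mathbb{B}^{[\ell-1]}_{n,\lambda}\ (\ell\ge2,\ n\ge1),$$ $$\mathbb{B}^{[\ell]}_{n,1}:=\Gamma^{[\ell]}_n\ (n\ge1),\qquad \mathbb{B}^{[\ell]}_{n,\lambda}:=\sum_{i=\lambda-1}^{n-1}\binom{n-1}{i}\Gamma^{[\ell]}_{n-i}\,\mathbb{B}^{[\ell]}_{i,\lambda-1}\ (\ell\ge1,\ n\ge\lambda\ge2).$$ For a multiindex $\boldsymbol\nu=(\nu_j)_{j\ge1}$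 of nonnegative integers with $|\boldsymbol\nu|:=\sum_j\nu_j<\infty$, write $\boldsymbol\beta^{\boldsymbol\nu}:=\prod_j\beta_j^{\nu_j}$ and $\partial^{\boldsymbol\nu}:=\prod_j(\partial/\partial y_j)^{\nu_j}$, where $\partial/\partial y_j$ is zero for $j>s$, since the functions do not depend on $y_j$. Write $\boldsymbol m\le\boldsymbol\nu$ if $m_j\le\nu_j$ for all $j$, and $\mathcal S(\boldsymbol\nu,\boldsymbol m):=\prod_j\mathcal S(\nu_j,m_j)$, where $\mathcal S(n,k)$ is the Stirling number of the second kind, with $\mathcal S(0,0)=1$. Then for every $1\le\ell\le L$ and every $1\le p\le d_{\ell+1}$, the component $G^{[\ell]}(\cdot)_p$ of each of the two networks is smooth on $\mathbb{R}^s$, and for every multiindex $\boldsymbol\nu\neq\boldsymbol0$ with $|\boldsymbol\nu|<\infty$ and every $\boldsymbol y\in\mathbb{R}^s$ (in particular every $\boldsymbol y\in[0,1]^s$) the following hold. (a) The non-periodic DNN satisfies $$|\partial^{\boldsymbol\nu}G^{[\ell]}(\boldsymbol y)_p|\le R_\ell\,\boldsymbol\beta^{\boldsymbol\nu}\,\Gamma^{[\ell]}_{|\boldsymbol\nu|}.$$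 (b) The periodic DNN satisfies $$|\partial^{\boldsymbol\nu}G^{[\ell]}(\boldsymbol y)_p|\le R_\ell\,(2\pi)^{|\boldsymbol\nu|}\sum_{\boldsymbol m\le\boldsymbol\nu}\boldsymbol\beta^{\boldsymbol m}\,\Gamma^{[\ell]}_{|\boldsymbol m|}\,\mathcal S(\boldsymbol\nu,\boldsymbol m),$$ where the term $\boldsymbol m=\boldsymbol0$ is zero because $\mathcal S(\boldsymbol\nu,\boldsymbol0)=0$. -/

import Mathlib

open scoped ContDiff Matrix

/-- `max_p |M p j|`, the vector `∞`-norm of the `j`-th column of `M`. -/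
noncomputable def columnInftyNorm {m n : ℕ} (M : Matrix (Fin m) (Fin n) ℝ) (j : Fin n) : ℝ :=
  ⨆ p : Fin m, |M p j|

/-- `max_p ∑_q |M p q|`, the matrix `∞`-norm (maximum absolute row sum) of `M`. -/
noncomputable def matrixInftyNorm {m n : ℕ} (M : Matrix (Fin m) (Fin n) ℝ) : ℝ :=
  ⨆ p : Fin m, ∑ q : Fin n, |M p q|

/-- The non-periodic feed-forward network of depth `ℓ` with widths `d 0, d 1, …`:
`G^[0](y) = W₀ y + v₀` and `G^[ℓ](y) = W_ℓ σ(G^[ℓ-1](y)) + v_ℓ`, where the activation function `σ`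
is applied componentwise. -/
def nonperiodicDNN (σ : ℝ → ℝ) {d : ℕ → ℕ}
    (W : (ℓ : ℕ) → Matrix (Fin (d (ℓ + 1))) (Fin (d ℓ)) ℝ) (v : (ℓ : ℕ) → Fin (d (ℓ + 1)) → ℝ) :
    (ℓ : ℕ) → (Fin (d 0) → ℝ) → Fin (d (ℓ + 1)) → ℝ
  | 0, y => W 0 *ᵥ y + v 0
  | ℓ + 1, y => W (ℓ + 1) *ᵥ (fun q => σ (nonperiodicDNN σ W v ℓ y q)) + v (ℓ + 1)

/-- The periodic network of depth `ℓ`: `G^[0](y) = W₀ sin(2πy) + v₀` and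
`G^[ℓ](y) = W_ℓ σ(G^[ℓ-1](y)) + v_ℓ`, with `sin` and `σ` applied componentwise. -/
noncomputable def periodicDNN (σ : ℝ → ℝ) {d : ℕ → ℕ}
    (W : (ℓ : ℕ) → Matrix (Fin (d (ℓ + 1))) (Fin (d ℓ)) ℝ) (v : (ℓ : ℕ) → Fin (d (ℓ + 1)) → ℝ) :
    (ℓ : ℕ) → (Fin (d 0) → ℝ) → Fin (d (ℓ + 1)) → ℝ
  | 0, y => W 0 *ᵥ (fun j => Real.sin (2 * Real.pi * y j)) + v 0
  | ℓ + 1, y => W (ℓ + 1) *ᵥ (fun q => σ (periodicDNN σ W v ℓ y q)) + v (ℓ + 1)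

/-- The partial derivative with respect to the variable with index `j` (indices start at `0`) of a
function of `s` real variables. For `j ≥ s` the function does not depend on that variable; the
direction vector below is then zero, and so is the derivative. -/
noncomputable def partialDeriv {s : ℕ} (j : ℕ) (f : (Fin s → ℝ) → ℝ) : (Fin s → ℝ) → ℝ :=
  fun y => lineDeriv ℝ f y (fun i : Fin s => if (i : ℕ) = j then 1 else 0)

/-- The mixed partial derivative `∂^ν = ∏_j (∂/∂y_j)^(ν_j)` of a function of `s` real variables, for
a finitely supported multiindex `ν`; the derivatives are composed in the order of the indices. -/
noncomputable def mixedPartial {s : ℕ} (ν : ℕ →₀ ℕ) (f : (Fin s → ℝ) → ℝ) : (Fin s → ℝ) → ℝ :=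
  (ν.support.sort (· ≤ ·)).foldr (fun j g => (partialDeriv j)^[ν j] g) f

/-- `β^ν = ∏_j β_j^(ν_j)`. -/
def multiPow (β : ℕ → ℝ) (ν : ℕ →₀ ℕ) : ℝ :=
  ∏ j ∈ ν.support, β j ^ ν j

/-- `S(ν, m) = ∏_j S(ν_j, m_j)`, a product of Stirling numbers of the second kind; the factors with
`ν_j = m_j = 0` are `S(0, 0) = 1`. -/
def multiStirling (ν m : ℕ →₀ ℕ) : ℕ :=
  ∏ j ∈ ν.support ∪ m.support, Nat.stirlingSecond (ν j) (m j)

/-- For a sequence `Γ` the numbers `B_{n,k}` with `B_{n,1} = Γ_n` and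
`B_{n,k} = ∑_{i=k-1}^{n-1} (n-1 choose i) Γ_{n-i} B_{i,k-1}` for `n ≥ k ≥ 2`.
The value at `k = 0` is never used, and for `n < k`, `k ≥ 2` the sum is empty. -/
def bSeq (Γ : ℕ → ℝ) : ℕ → ℕ → ℝ
  | _, 0 => 0
  | n, 1 => Γ n
  | n, k + 2 => ∑ i ∈ Finset.Icc (k + 1) (n - 1),
      ((n - 1).choose i : ℝ) * Γ (n - i) * bSeq Γ i (k + 1)

/-- The numbers `Γ_n^[ℓ]` with `Γ_n^[1] = A_n` and
`Γ_n^[ℓ] = ∑_{k=1}^n A_k R_{ℓ-1}^k B_{n,k}^[ℓ-1]` for `ℓ ≥ 2`, where `B_{n,k}^[ℓ-1]` is formed from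
the sequence `n ↦ Γ_n^[ℓ-1]`. Only the values with `ℓ ≥ 1` and `n ≥ 1` matter. -/
def gammaSeq (A R : ℕ → ℝ) : ℕ → ℕ → ℝ
  | 0, _ => 0
  | 1, n => A n
  | ℓ + 2, n => ∑ k ∈ Finset.Icc 1 n, A k * R (ℓ + 1) ^ k * bSeq (gammaSeq A R (ℓ + 1)) n k

/-!
The bounds come from the recursive structure of the derivatives of a composition, and no closed form
of Faà di Bruno's formula is needed.

A mixed partial derivative of a smooth function is a derivative along a list of variables
(`exists_list_mixedPartial`). A sequence `c` controls a function if its derivative along every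
nonempty list of length `n` is at most `c n` times the product of the weights `β j` over the list.
Since this bound depends on the list only through its length and a multiplicative weight, the
Leibniz rule turns into a binomial convolution of the controlling sequences
(`abs_listDeriv_mul_le`). Writing `∂_j (σ ∘ g) = ∂_j g · (σ' ∘ g)` and inducting on the length of the
list, for all activation functions at once, one finds that `σ ∘ g` is controlled by the numbers
`∑_k A_k B_{n,k}`, where `B` is formed from `c`: the recursion of `bSeq` is the one that the
convolution produces (`compBound_succ`, `abs_listDeriv_comp_le`). Taking linear combinations costs
the row sum of the weight matrix, and `B` is homogeneous of degree `k` in `c` (`bSeq_mul`), so that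
each layer reproduces the recursion of `gammaSeq`. The affine input layer is controlled by the
sequence `1, 0, 0, …`, for which `B_{n,k}` is the Kronecker delta; this gives `Γ^[1] = A`.

The periodic network is the non-periodic one composed with `y ↦ sin (2πy)`. In one variable,
`(f (sin 2πx))^(n) = ∑_k P_{n,k}(x) f^(k)(sin 2πx)`, where the derivatives of `P_{n,k}` of order `m`
are bounded by `(2π)^(n+m) S(n,k) k^m` (`abs_iteratedDeriv_sinCoeff_le`). The coefficients depend on
one variable only and are constants for the others, so that the expansion can be applied to one
variable after another; this yields the Stirling sum (`abs_mixedPartial_comp_sinMap_le`), into which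
the bound for the non-periodic network is inserted.
-/

/-! ### Partial derivatives of smooth functions -/

/-- The direction vector of `partialDeriv j`: the `j`-th unit vector, or `0` if `j ≥ s`. -/
def partialDir (s j : ℕ) : Fin s → ℝ := fun i => if (i : ℕ) = j then 1 else 0

lemma partialDeriv_eq_fderiv {s : ℕ} {f : (Fin s → ℝ) → ℝ} (hf : ContDiff ℝ ∞ f) (j : ℕ) :
    partialDeriv j f = fun y => fderiv ℝ f y (partialDir s j) := by
  funext y
  exact ((hf.differentiable (by simp)) y).lineDeriv_eq_fderiv

lemma ContDiff.partialDeriv {s : ℕ} {f : (Fin s → ℝ) → ℝ} (hf : ContDiff ℝ ∞ f) (j : ℕ) :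
    ContDiff ℝ ∞ (partialDeriv j f) := by
  rw [partialDeriv_eq_fderiv hf]
  exact (hf.fderiv_right (m := ∞) (by simp)).clm_apply contDiff_const

lemma ContDiff.iterate_partialDeriv {s : ℕ} {f : (Fin s → ℝ) → ℝ} (hf : ContDiff ℝ ∞ f)
    (j n : ℕ) : ContDiff ℝ ∞ ((_root_.partialDeriv j)^[n] f) := by
  induction n with
  | zero => exact hf
  | succ n ih =>
    rw [Function.iterate_succ_apply']
    exact ih.partialDeriv j

lemma ContDiff.deriv_infty {f : ℝ → ℝ} (hf : ContDiff ℝ ∞ f) : ContDiff ℝ ∞ (deriv f) :=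
  (contDiff_infty_iff_deriv.1 hf).2

lemma partialDeriv_add {s : ℕ} {f g : (Fin s → ℝ) → ℝ} (hf : ContDiff ℝ ∞ f)
    (hg : ContDiff ℝ ∞ g) (j : ℕ) :
    partialDeriv j (fun y => f y + g y) = fun y => partialDeriv j f y + partialDeriv j g y := by
  rw [partialDeriv_eq_fderiv (hf.add hg), partialDeriv_eq_fderiv hf, partialDeriv_eq_fderiv hg]
  funext y
  rw [fderiv_fun_add (hf.differentiable (by simp) y) (hg.differentiable (by simp) y)]
  rfl

lemma partialDeriv_mul {s : ℕ} {f g : (Fin s → ℝ) → ℝ} (hf : ContDiff ℝ ∞ f)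
    (hg : ContDiff ℝ ∞ g) (j : ℕ) :
    partialDeriv j (fun y => f y * g y)
      = fun y => partialDeriv j f y * g y + f y * partialDeriv j g y := by
  rw [partialDeriv_eq_fderiv (hf.mul hg), partialDeriv_eq_fderiv hf, partialDeriv_eq_fderiv hg]
  funext y
  rw [fderiv_fun_mul (hf.differentiable (by simp) y) (hg.differentiable (by simp) y)]
  simp only [add_apply, smul_apply, smul_eq_mul]
  ring

lemma partialDeriv_const {s : ℕ} (c : ℝ) (j : ℕ) :
    partialDeriv j (fun _ : Fin s → ℝ => c) = fun _ => 0 := by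
  rw [partialDeriv_eq_fderiv contDiff_const]
  simp

lemma partialDeriv_sum_mul {s : ℕ} {ι : Type*} (t : Finset ι) (c : ι → ℝ)
    {f : ι → (Fin s → ℝ) → ℝ} (hf : ∀ i, ContDiff ℝ ∞ (f i)) (j : ℕ) :
    partialDeriv j (fun y => ∑ i ∈ t, c i * f i y)
      = fun y => ∑ i ∈ t, c i * partialDeriv j (f i) y := by
  have hs : ContDiff ℝ ∞ (fun y => ∑ i ∈ t, c i * f i y) :=
    ContDiff.sum fun i _ => contDiff_const.mul (hf i)
  rw [partialDeriv_eq_fderiv hs]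
  funext y
  have h : HasFDerivAt (fun y => ∑ i ∈ t, c i * f i y) (∑ i ∈ t, c i • fderiv ℝ (f i) y) y :=
    HasFDerivAt.fun_sum fun i _ => ((hf i).differentiable (by simp) y).hasFDerivAt.const_mul (c i)
  rw [h.fderiv]
  simp [partialDeriv_eq_fderiv (hf _)]

/-- The chain rule for a partial derivative of `σ ∘ g`. -/
lemma partialDeriv_comp {s : ℕ} {σ : ℝ → ℝ} (hσ : ContDiff ℝ ∞ σ) {g : (Fin s → ℝ) → ℝ}
    (hg : ContDiff ℝ ∞ g) (j : ℕ) :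
    partialDeriv j (fun y => σ (g y)) = fun y => partialDeriv j g y * deriv σ (g y) := by
  rw [partialDeriv_eq_fderiv (f := fun y => σ (g y)) (hσ.comp hg), partialDeriv_eq_fderiv hg]
  funext y
  have h := (hσ.differentiable (by simp) (g y)).hasDerivAt.comp_hasFDerivAt y
    (hg.differentiable (by simp) y).hasFDerivAt
  change fderiv ℝ (σ ∘ g) y _ = _
  rw [h.fderiv]
  simp [mul_comm]

/-- A factor depending only on the variable `y a` is constant for `∂/∂y_j` with `j ≠ a`. -/
lemma partialDeriv_sum_coord_mul {s : ℕ} {ι : Type*} (t : Finset ι) (a : Fin s) (c : ι → ℝ → ℝ)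
    {f : ι → (Fin s → ℝ) → ℝ} (hf : ∀ i, ContDiff ℝ ∞ (f i)) {j : ℕ} (hj : (a : ℕ) ≠ j) :
    partialDeriv j (fun y => ∑ i ∈ t, c i (y a) * f i y)
      = fun y => ∑ i ∈ t, c i (y a) * partialDeriv j (f i) y := by
  funext y
  have h := congrFun (partialDeriv_sum_mul t (fun i => c i (y a)) hf j) y
  rw [← h]
  simp [partialDeriv, lineDeriv, hj]

lemma iterate_partialDeriv_sum_coord_mul {s : ℕ} {ι : Type*} (t : Finset ι) (a : Fin s)
    (c : ι → ℝ → ℝ) {f : ι → (Fin s → ℝ) → ℝ} (hf : ∀ i, ContDiff ℝ ∞ (f i)) {j : ℕ}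
    (hj : (a : ℕ) ≠ j) (n : ℕ) :
    (partialDeriv j)^[n] (fun y => ∑ i ∈ t, c i (y a) * f i y)
      = fun y => ∑ i ∈ t, c i (y a) * (partialDeriv j)^[n] (f i) y := by
  induction n with
  | zero => rfl
  | succ n ih =>
    rw [Function.iterate_succ_apply', ih,
      partialDeriv_sum_coord_mul t a c (fun i => (hf i).iterate_partialDeriv j n) hj]
    simp only [Function.iterate_succ_apply']

/-! ### Derivatives along lists of variables -/

/-- The partial derivatives with respect to the variables listed in `l`, with repetitions, the head
of the list being applied first. -/
noncomputable def listDeriv {s : ℕ} (l : List ℕ) (f : (Fin s → ℝ) → ℝ) : (Fin s → ℝ) → ℝ :=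
  l.foldl (fun g j => partialDeriv j g) f

lemma listDeriv_cons {s : ℕ} (j : ℕ) (l : List ℕ) (f : (Fin s → ℝ) → ℝ) :
    listDeriv (j :: l) f = listDeriv l (partialDeriv j f) := rfl

lemma listDeriv_add {s : ℕ} (l : List ℕ) {f g : (Fin s → ℝ) → ℝ} (hf : ContDiff ℝ ∞ f)
    (hg : ContDiff ℝ ∞ g) :
    listDeriv l (fun y => f y + g y) = fun y => listDeriv l f y + listDeriv l g y := by
  induction l generalizing f g with
  | nil => rfl
  | cons j l ih =>
    simp only [listDeriv_cons]
    rw [partialDeriv_add hf hg, ih (hf.partialDeriv j) (hg.partialDeriv j)]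

lemma listDeriv_const {s : ℕ} {l : List ℕ} (hl : l ≠ []) (c : ℝ) :
    listDeriv l (fun _ : Fin s → ℝ => c) = fun _ => 0 := by
  induction l generalizing c with
  | nil => exact absurd rfl hl
  | cons j l ih =>
    rw [listDeriv_cons, partialDeriv_const]
    by_cases h : l = []
    · subst h; rfl
    · exact ih h 0

lemma listDeriv_sum_mul {s : ℕ} {ι : Type*} (t : Finset ι) (c : ι → ℝ)
    {f : ι → (Fin s → ℝ) → ℝ} (hf : ∀ i, ContDiff ℝ ∞ (f i)) (l : List ℕ) :
    listDeriv l (fun y => ∑ i ∈ t, c i * f i y) = fun y => ∑ i ∈ t, c i * listDeriv l (f i) y := by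
  induction l generalizing f with
  | nil => rfl
  | cons j l ih =>
    simp only [listDeriv_cons]
    rw [partialDeriv_sum_mul t c hf, ih fun i => (hf i).partialDeriv j]

/-- The Leibniz rule for bounds: if the derivatives of `f` and `g` along a list of length `k ≤ n`
are bounded by `a k` and `b k` times the product of the weights `β`, those of `f * g` along lists of
length `n` are bounded by the binomial convolution of `a` and `b`. -/
lemma abs_listDeriv_mul_le {s : ℕ} {β : ℕ → ℝ} (n : ℕ) {f g : (Fin s → ℝ) → ℝ} {a b : ℕ → ℝ}
    (hf : ContDiff ℝ ∞ f) (hg : ContDiff ℝ ∞ g)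
    (ha : ∀ l : List ℕ, l.length ≤ n → ∀ y, |listDeriv l f y| ≤ a l.length * (l.map β).prod)
    (hb : ∀ l : List ℕ, l.length ≤ n → ∀ y, |listDeriv l g y| ≤ b l.length * (l.map β).prod)
    (l : List ℕ) (hl : l.length = n) (y : Fin s → ℝ) :
    |listDeriv l (fun y => f y * g y) y|
      ≤ (∑ i ∈ Finset.range (n + 1), (n.choose i : ℝ) * (b i * a (n - i))) * (l.map β).prod := by
  induction n generalizing f g a b l with
  | zero =>
    obtain rfl := List.eq_nil_of_length_eq_zero hl
    have h1 := ha [] le_rfl y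
    have h2 := hb [] le_rfl y
    simp only [listDeriv, List.foldl_nil, List.length_nil, List.map_nil, List.prod_nil,
      mul_one] at h1 h2
    simp only [listDeriv, List.foldl_nil, abs_mul, List.map_nil, List.prod_nil, mul_one]
    simpa [mul_comm] using mul_le_mul h1 h2 (abs_nonneg _) ((abs_nonneg _).trans h1)
  | succ n ih =>
    obtain _ | ⟨j, l⟩ := l
    · simp at hl
    replace hl : l.length = n := by simpa using hl
    have hf' := hf.partialDeriv j
    have hg' := hg.partialDeriv j
    have key1 := ih (a := fun k => β j * a (k + 1)) (b := b) hf' hg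
      (fun l hl y => by
        have := ha (j :: l) (by simpa using hl) y
        simp only [List.length_cons, List.map_cons, List.prod_cons] at this
        calc _ ≤ _ := this
          _ = _ := by ring)
      (fun l hl y => hb l (by omega) y) l hl
    have key2 := ih (a := a) (b := fun k => β j * b (k + 1)) hf hg'
      (fun l hl y => ha l (by omega) y)
      (fun l hl y => by
        have := hb (j :: l) (by simpa using hl) y
        simp only [List.length_cons, List.map_cons, List.prod_cons] at this
        calc _ ≤ _ := this
          _ = _ := by ring) l hl
    rw [listDeriv_cons, partialDeriv_mul hf hg, listDeriv_add l (hf'.mul hg) (hf.mul hg')]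
    refine (abs_add_le _ _).trans ((add_le_add key1 key2).trans_eq ?_)
    rw [Finset.sum_choose_succ_mul (fun i k => b i * a k) n, List.map_cons, List.prod_cons,
      ← add_mul, ← mul_assoc, ← Finset.sum_add_distrib, ← Finset.sum_add_distrib,
      Finset.sum_mul _ _ (β j)]
    congr 1
    refine Finset.sum_congr rfl fun i hi => ?_
    rw [Nat.succ_sub (Nat.lt_succ_iff.1 (Finset.mem_range.1 hi))]
    simp only [Nat.succ_eq_add_one]
    ring

/-! ### Bell-type numbers and compositions -/

/-- The bound for the `n`-th derivatives of `σ ∘ g` obtained from bounds `A k` on `σ^(k)` and `c k`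
on the `k`-th derivatives of `g`: `∑_{k=1}^n A_k B_{n,k}` with `B` formed from `c`, and `A_0` for
`n = 0`. -/
def compBound (A c : ℕ → ℝ) : ℕ → ℝ
  | 0 => A 0
  | n + 1 => ∑ k ∈ Finset.Icc 1 (n + 1), A k * bSeq c (n + 1) k

lemma bSeq_add_two (c : ℕ → ℝ) (n k : ℕ) :
    bSeq c n (k + 2) = ∑ i ∈ Finset.Icc (k + 1) (n - 1),
      ((n - 1).choose i : ℝ) * c (n - i) * bSeq c i (k + 1) := by
  rw [bSeq]

lemma bSeq_one (c : ℕ → ℝ) (n : ℕ) : bSeq c n 1 = c n := by rw [bSeq]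

/-- The recursion that `∂_j (σ ∘ g) = ∂_j g · σ' ∘ g` and the Leibniz rule produce; passing to `σ'`
shifts the sequence `A`. -/
lemma compBound_succ (A c : ℕ → ℝ) (n : ℕ) :
    compBound A c (n + 1) = ∑ i ∈ Finset.range (n + 1),
      (n.choose i : ℝ) * (compBound (fun k => A (k + 1)) c i * c (n - i + 1)) := by
  have hL : compBound A c (n + 1)
      = A 1 * c (n + 1) + ∑ k ∈ Finset.range n, A (k + 2) * bSeq c (n + 1) (k + 2) := by
    rw [compBound, ← Finset.Ico_succ_right_eq_Icc, Finset.sum_Ico_eq_sum_range]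
    simp only [Nat.succ_eq_succ, Nat.succ_eq_add_one, Nat.add_sub_cancel]
    rw [Finset.sum_range_succ']
    rw [add_comm]
    simp only [add_zero, bSeq_one]
    congr 1
    refine Finset.sum_congr rfl fun k _ => ?_
    rw [show 1 + (k + 1) = k + 2 by ring]
  have hR : ∀ i, compBound (fun k => A (k + 1)) c (i + 1)
      = ∑ k ∈ Finset.range (i + 1), A (k + 2) * bSeq c (i + 1) (k + 1) := by
    intro i
    rw [compBound, ← Finset.Ico_succ_right_eq_Icc, Finset.sum_Ico_eq_sum_range]
    simp only [Nat.succ_eq_succ, Nat.succ_eq_add_one, Nat.add_sub_cancel]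
    refine Finset.sum_congr rfl fun k _ => ?_
    rw [show 1 + k = k + 1 by ring]
  rw [hL, Finset.sum_range_succ', add_comm]
  congr 1
  · simp only [hR, bSeq_add_two, Finset.mul_sum, Finset.sum_mul, Nat.add_sub_cancel]
    have : ∀ k, ∑ i ∈ Finset.Icc (k + 1) n,
          A (k + 2) * ((n.choose i : ℝ) * c (n + 1 - i) * bSeq c i (k + 1))
        = ∑ i ∈ Finset.Ico k n,
          A (k + 2) * ((n.choose (i + 1) : ℝ) * c (n - i) * bSeq c (i + 1) (k + 1)) := by
      intro k
      rw [← Finset.Ico_succ_right_eq_Icc, Nat.succ_eq_succ, Nat.succ_eq_add_one,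
        ← Finset.sum_Ico_add' _ k n 1]
      simp
    simp only [this]
    rw [Finset.sum_comm' (t' := Finset.range n) (s' := fun i => Finset.range (i + 1))
      (by intro x y; simp; omega)]
    refine Finset.sum_congr rfl fun i hi => Finset.sum_congr rfl fun k _ => ?_
    rw [show n - (i + 1) + 1 = n - i by have := Finset.mem_range.1 hi; omega]
    ring
  · simp [compBound]

lemma bSeq_nonneg {c : ℕ → ℝ} (hc : ∀ n, 1 ≤ n → 0 ≤ c n) : ∀ n k, 1 ≤ n → 0 ≤ bSeq c n k
  | _, 0, _ => by simp [bSeq]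
  | n, 1, hn => by rw [bSeq_one]; exact hc n hn
  | n, k + 2, hn => by
    rw [bSeq_add_two]
    refine Finset.sum_nonneg fun i hi => ?_
    rw [Finset.mem_Icc] at hi
    exact mul_nonneg (mul_nonneg (Nat.cast_nonneg _) (hc _ (by omega)))
      (bSeq_nonneg hc i (k + 1) (by omega))

lemma bSeq_mul (r : ℝ) (c : ℕ → ℝ) : ∀ n k, bSeq (fun m => r * c m) n k = r ^ k * bSeq c n k
  | _, 0 => by simp [bSeq]
  | n, 1 => by simp [bSeq_one]
  | n, k + 2 => by
    simp only [bSeq_add_two, Finset.mul_sum, bSeq_mul r c _ (k + 1)]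
    refine Finset.sum_congr rfl fun i _ => ?_
    ring

/-- For an affine inner function only the partition into singletons contributes. -/
lemma bSeq_ite_one : ∀ n k, 1 ≤ k →
    bSeq (fun m => if m = 1 then 1 else 0) n k = if n = k then 1 else 0
  | _, 0, h => by omega
  | n, 1, _ => by rw [bSeq_one]
  | n, k + 2, _ => by
    rw [bSeq_add_two]
    split_ifs with h
    · subst h
      rw [Finset.sum_eq_single (k + 1)]
      · simp [bSeq_ite_one _ (k + 1)]
      · intro i _ hi
        simp [bSeq_ite_one _ (k + 1), hi]
      · simp
    · refine Finset.sum_eq_zero fun i hi => ?_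
      rw [bSeq_ite_one _ (k + 1) (by omega)]
      by_cases h1 : i = k + 1
      · rw [if_neg (by omega)]; simp
      · simp [h1]

lemma compBound_ite_one (A : ℕ → ℝ) (n : ℕ) :
    compBound A (fun m => if m = 1 then 1 else 0) n = A n := by
  obtain _ | n := n
  · rfl
  · rw [compBound, Finset.sum_eq_single (n + 1)]
    · simp [bSeq_ite_one]
    · intro k hk hne
      simp [bSeq_ite_one _ _ (Finset.mem_Icc.1 hk).1, hne.symm]
    · simp

lemma compBound_mul_gammaSeq (A R : ℕ → ℝ) {ℓ n : ℕ} (hn : 1 ≤ n) :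
    compBound A (fun m => R (ℓ + 1) * gammaSeq A R (ℓ + 1) m) n = gammaSeq A R (ℓ + 2) n := by
  obtain ⟨n, rfl⟩ := Nat.exists_eq_add_of_le' hn
  rw [compBound, gammaSeq]
  simp only [bSeq_mul, mul_assoc]

lemma gammaSeq_nonneg {A R : ℕ → ℝ} (hA : ∀ n, 1 ≤ n → 0 < A n) (hR : ∀ ℓ, 1 ≤ ℓ → 0 < R ℓ) :
    ∀ ℓ n, 1 ≤ n → 0 ≤ gammaSeq A R ℓ n
  | 0, _, _ => by simp [gammaSeq]
  | 1, n, hn => by rw [gammaSeq]; exact (hA n hn).le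
  | ℓ + 2, n, hn => by
    rw [gammaSeq]
    exact Finset.sum_nonneg fun k hk => mul_nonneg
      (mul_nonneg (hA k (Finset.mem_Icc.1 hk).1).le (pow_nonneg (hR _ (by omega)).le _))
      (bSeq_nonneg (gammaSeq_nonneg hA hR (ℓ + 1)) _ _ hn)

/-- The bounds for the derivatives of `σ ∘ g`, a form of Faà di Bruno's formula in which all
partitions with the same block sizes are bounded alike. -/
lemma abs_listDeriv_comp_le {s : ℕ} {β c : ℕ → ℝ} {g : (Fin s → ℝ) → ℝ} (hg : ContDiff ℝ ∞ g)
    (hc : ∀ l : List ℕ, l ≠ [] → ∀ y, |listDeriv l g y| ≤ c l.length * (l.map β).prod)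
    {σ : ℝ → ℝ} {A : ℕ → ℝ} (hσ : ContDiff ℝ ∞ σ)
    (hA : ∀ n, 1 ≤ n → ∀ x : ℝ, |iteratedDeriv n σ x| ≤ A n)
    (l : List ℕ) (hl : l ≠ []) (y : Fin s → ℝ) :
    |listDeriv l (fun y => σ (g y)) y| ≤ compBound A c l.length * (l.map β).prod := by
  obtain ⟨n, hn⟩ : ∃ n, l.length = n := ⟨_, rfl⟩
  induction n using Nat.strong_induction_on generalizing σ A l y with
  | _ n ih =>
  obtain _ | ⟨j, l⟩ := l
  · exact absurd rfl hl
  have hσ' := hσ.deriv_infty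
  have hA' : ∀ n, 1 ≤ n → ∀ x : ℝ, |iteratedDeriv n (deriv σ) x| ≤ A (n + 1) := by
    intro n _ x
    rw [← iteratedDeriv_succ']
    exact hA (n + 1) (by omega) x
  rw [listDeriv_cons, partialDeriv_comp hσ hg]
  refine (abs_listDeriv_mul_le (β := β) l.length (a := fun k => β j * c (k + 1))
    (b := compBound (fun k => A (k + 1)) c) (hg.partialDeriv j) (hσ'.comp hg) ?_ ?_ l rfl y).trans_eq
    ?_
  · intro l' _ y
    refine (hc (j :: l') (by simp) y).trans_eq ?_
    simp only [List.length_cons, List.map_cons, List.prod_cons]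
    ring
  · intro l' hl' y
    by_cases h : l' = []
    · subst h
      simpa [listDeriv, compBound] using hA 1 le_rfl (g y)
    · exact ih l'.length (by simp at hn; omega) hσ' hA' l' h y rfl
  · rw [List.length_cons, compBound_succ, List.map_cons, List.prod_cons, ← mul_assoc,
      Finset.sum_mul _ _ (β j)]
    congr 1
    refine Finset.sum_congr rfl fun i _ => ?_
    ring

/-! ### Mixed partial derivatives -/

lemma listDeriv_append {s : ℕ} (l₁ l₂ : List ℕ) (f : (Fin s → ℝ) → ℝ) :
    listDeriv (l₁ ++ l₂) f = listDeriv l₂ (listDeriv l₁ f) := List.foldl_append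

lemma listDeriv_replicate {s : ℕ} (n j : ℕ) (f : (Fin s → ℝ) → ℝ) :
    listDeriv (List.replicate n j) f = (partialDeriv j)^[n] f := by
  induction n generalizing f with
  | zero => rfl
  | succ n ih => rw [List.replicate_succ, listDeriv_cons, ih, Function.iterate_succ_apply]

lemma mixedPartial_zero {s : ℕ} (f : (Fin s → ℝ) → ℝ) : mixedPartial 0 f = f := by
  simp [mixedPartial]

/-- The derivatives with respect to the variable of largest index are applied first. -/
lemma mixedPartial_single_add {s : ℕ} {a : ℕ} (n : ℕ) {ν : ℕ →₀ ℕ} (h : ∀ c ∈ ν.support, c < a)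
    (f : (Fin s → ℝ) → ℝ) :
    mixedPartial (Finsupp.single a n + ν) f = mixedPartial ν ((partialDeriv a)^[n] f) := by
  obtain rfl | hn := eq_or_ne n 0
  · simp
  have ha : a ∉ ν.support := fun h' => (h a h').ne rfl
  have hdisj : Disjoint (Finsupp.single a n).support ν.support := by
    rw [Finsupp.support_single _ hn]
    simpa using ha
  have hsupp : (Finsupp.single a n + ν).support = insert a ν.support := by
    rw [Finsupp.support_add_eq hdisj, Finsupp.support_single _ hn]
    rfl
  have hsort : (insert a ν.support).sort (· ≤ ·) = ν.support.sort (· ≤ ·) ++ [a] := by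
    have hnd : (ν.support.sort (· ≤ ·) ++ [a]).Nodup := by
      rw [List.nodup_append]
      refine ⟨Finset.sort_nodup _ _, List.nodup_singleton a, ?_⟩
      intro x hx y hy
      rw [Finset.mem_sort] at hx
      rw [List.mem_singleton] at hy
      exact hy ▸ (h x hx).ne
    have hset : insert a ν.support = (ν.support.sort (· ≤ ·) ++ [a]).toFinset := by
      ext x
      simp
    rw [hset, List.toFinset_sort _ hnd, List.pairwise_append]
    refine ⟨Finset.pairwise_sort _ _, List.pairwise_singleton _ _, ?_⟩
    intro x hx y hy
    rw [Finset.mem_sort] at hx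
    rw [List.mem_singleton] at hy
    exact hy ▸ (h x hx).le
  have hνa : ν a = 0 := Finsupp.notMem_support_iff.1 ha
  rw [mixedPartial, hsupp, hsort, List.foldr_append, mixedPartial]
  simp only [List.foldr_cons, List.foldr_nil, Finsupp.add_apply, Finsupp.single_eq_same, hνa,
    add_zero]
  refine List.foldr_ext _ _ _ fun j hj g => ?_
  rw [Finset.mem_sort] at hj
  rw [Finsupp.single_eq_of_ne (h j hj).ne, zero_add]

lemma multiPow_single_add (β : ℕ → ℝ) (a n : ℕ) (ν : ℕ →₀ ℕ) :
    multiPow β (Finsupp.single a n + ν) = β a ^ n * multiPow β ν := by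
  have h := Finsupp.prod_add_index' (f := Finsupp.single a n) (g := ν) (h := fun j k => β j ^ k)
    (fun _ => pow_zero _) (fun _ _ _ => pow_add _ _ _)
  rw [Finsupp.prod_single_index (h := fun j k => β j ^ k) (pow_zero _)] at h
  exact h

/-- Every mixed partial derivative is a derivative along a list of variables. -/
lemma exists_list_mixedPartial (s : ℕ) (β : ℕ → ℝ) (ν : ℕ →₀ ℕ) :
    ∃ l : List ℕ, l.length = ν.degree ∧ (l.map β).prod = multiPow β ν ∧
      ∀ f : (Fin s → ℝ) → ℝ, mixedPartial ν f = listDeriv l f := by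
  induction ν using Finsupp.induction_on_max with
  | zero => exact ⟨[], by simp, by simp [multiPow], mixedPartial_zero⟩
  | single_add a n ν h _ ih =>
    obtain ⟨l, h1, h2, h3⟩ := ih
    refine ⟨List.replicate n a ++ l, ?_, ?_, fun f => ?_⟩
    · simp [h1, map_add]
    · simp [h2, multiPow_single_add]
    · rw [mixedPartial_single_add n h, h3, listDeriv_append, listDeriv_replicate]

/-! ### The non-periodic network -/

/-- One layer of a network applied to inner functions whose derivatives are bounded by `c`. -/
lemma abs_listDeriv_layer_le {s m : ℕ} {β c A : ℕ → ℝ} {g : Fin m → (Fin s → ℝ) → ℝ}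
    (hg : ∀ q, ContDiff ℝ ∞ (g q))
    (hc : ∀ q, ∀ l : List ℕ, l ≠ [] → ∀ y,
      |listDeriv l (g q) y| ≤ c l.length * (l.map β).prod)
    {σ : ℝ → ℝ} (hσ : ContDiff ℝ ∞ σ) (hA : ∀ n, 1 ≤ n → ∀ x : ℝ, |iteratedDeriv n σ x| ≤ A n)
    (hβ : ∀ j, 0 < β j) {w : Fin m → ℝ} {r : ℝ} (hw : ∑ q, |w q| ≤ r) (v : ℝ)
    (l : List ℕ) (hl : l ≠ []) (h0 : 0 ≤ compBound A c l.length) (y : Fin s → ℝ) :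
    |listDeriv l (fun y => ∑ q, w q * σ (g q y) + v) y|
      ≤ r * compBound A c l.length * (l.map β).prod := by
  have hs : ∀ q, ContDiff ℝ ∞ (fun y => σ (g q y)) := fun q => hσ.comp (hg q)
  have hβl : 0 ≤ (l.map β).prod := List.prod_nonneg (by
    intro x hx
    obtain ⟨j, _, rfl⟩ := List.mem_map.1 hx
    exact (hβ j).le)
  rw [listDeriv_add l (ContDiff.sum fun q _ => contDiff_const.mul (hs q)) contDiff_const,
    listDeriv_const hl, listDeriv_sum_mul _ _ hs]
  simp only [add_zero]
  calc |∑ q, w q * listDeriv l (fun y => σ (g q y)) y|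
      ≤ ∑ q, |w q| * (compBound A c l.length * (l.map β).prod) := by
        refine (Finset.abs_sum_le_sum_abs _ _).trans (Finset.sum_le_sum fun q _ => ?_)
        rw [abs_mul]
        exact mul_le_mul_of_nonneg_left (abs_listDeriv_comp_le (hg q) (hc q) hσ hA l hl y)
          (abs_nonneg _)
    _ ≤ r * (compBound A c l.length * (l.map β).prod) := by
        rw [← Finset.sum_mul]
        exact mul_le_mul_of_nonneg_right hw (mul_nonneg h0 hβl)
    _ = _ := by ring

/-- The derivatives of the affine input layer: those of order at least two vanish. -/
lemma abs_listDeriv_affine_le {s : ℕ} {β : ℕ → ℝ} (hβ_pos : ∀ j, 0 < β j) {w : Fin s → ℝ}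
    (hw : ∀ j, |w j| ≤ β j) (v : ℝ) (l : List ℕ) (hl : l ≠ []) (y : Fin s → ℝ) :
    |listDeriv l (fun y => ∑ q, w q * y q + v) y|
      ≤ (if l.length = 1 then 1 else 0) * (l.map β).prod := by
  obtain _ | ⟨j, l⟩ := l
  · exact absurd rfl hl
  have hcoord : ∀ q : Fin s, ContDiff ℝ ∞ (fun y : Fin s → ℝ => y q) := fun q =>
    contDiff_apply ℝ ℝ q
  have h1 : partialDeriv j (fun y => ∑ q, w q * y q + v)
      = fun _ => ∑ q, w q * partialDir s j q := by
    rw [partialDeriv_add (ContDiff.sum fun q _ => contDiff_const.mul (hcoord q)) contDiff_const,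
      partialDeriv_const, partialDeriv_sum_mul _ _ hcoord]
    funext y
    simp only [add_zero]
    refine Finset.sum_congr rfl fun q _ => ?_
    rw [partialDeriv_eq_fderiv (hcoord q)]
    have := (hasFDerivAt_apply (𝕜 := ℝ) q y).fderiv
    simp only [this]
    rfl
  rw [listDeriv_cons, h1]
  obtain _ | ⟨i, l⟩ := l
  · simp only [listDeriv, List.foldl_nil, List.length_singleton, if_true, List.map_singleton,
      List.prod_singleton, one_mul]
    by_cases hj : j < s
    · rw [Finset.sum_eq_single ⟨j, hj⟩]
      · simpa [partialDir] using hw ⟨j, hj⟩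
      · intro q _ hq
        rw [partialDir, if_neg (fun h => hq (Fin.ext h)), mul_zero]
      · simp
    · rw [Finset.sum_eq_zero]
      · simpa using (hβ_pos j).le
      · intro q _
        rw [partialDir, if_neg (by have := q.2; omega), mul_zero]
  · rw [listDeriv_const (by simp)]
    simp

section Network

variable {d : ℕ → ℕ} {W : (ℓ : ℕ) → Matrix (Fin (d (ℓ + 1))) (Fin (d ℓ)) ℝ}
  {v : (ℓ : ℕ) → Fin (d (ℓ + 1)) → ℝ} {σ : ℝ → ℝ}

lemma nonperiodicDNN_zero_apply (y : Fin (d 0) → ℝ) (p : Fin (d 1)) :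
    nonperiodicDNN σ W v 0 y p = ∑ q, W 0 p q * y q + v 0 p := by
  rw [nonperiodicDNN]
  rfl

lemma nonperiodicDNN_succ_apply (ℓ : ℕ) (y : Fin (d 0) → ℝ) (p : Fin (d (ℓ + 2))) :
    nonperiodicDNN σ W v (ℓ + 1) y p
      = ∑ q, W (ℓ + 1) p q * σ (nonperiodicDNN σ W v ℓ y q) + v (ℓ + 1) p := by
  rw [nonperiodicDNN]
  rfl

lemma contDiff_nonperiodicDNN (hσ : ContDiff ℝ ∞ σ) (ℓ : ℕ) (p : Fin (d (ℓ + 1))) :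
    ContDiff ℝ ∞ (fun y => nonperiodicDNN σ W v ℓ y p) := by
  induction ℓ with
  | zero =>
    simp only [nonperiodicDNN_zero_apply]
    exact (ContDiff.sum fun q _ => contDiff_const.mul (contDiff_apply ℝ ℝ q)).add contDiff_const
  | succ ℓ ih =>
    simp only [nonperiodicDNN_succ_apply]
    exact (ContDiff.sum fun q _ => contDiff_const.mul (hσ.comp (ih q))).add contDiff_const

lemma abs_listDeriv_nonperiodicDNN_le {β R A : ℕ → ℝ} {L : ℕ}
    (hβ_pos : ∀ j, 0 < β j) (hR_pos : ∀ ℓ, 1 ≤ ℓ → 0 < R ℓ) (hA_pos : ∀ n, 1 ≤ n → 0 < A n)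
    (hβ : ∀ j : Fin (d 0), columnInftyNorm (W 0) j ≤ β j)
    (hR : ∀ ℓ, 1 ≤ ℓ → ℓ ≤ L → matrixInftyNorm (W ℓ) ≤ R ℓ)
    (hσ : ContDiff ℝ ∞ σ) (hA : ∀ n, 1 ≤ n → ∀ x : ℝ, |iteratedDeriv n σ x| ≤ A n)
    (ℓ : ℕ) (hℓ : ℓ + 1 ≤ L) (p : Fin (d (ℓ + 2))) (l : List ℕ) (hl : l ≠ [])
    (y : Fin (d 0) → ℝ) :
    |listDeriv l (fun y => nonperiodicDNN σ W v (ℓ + 1) y p) y|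
      ≤ R (ℓ + 1) * gammaSeq A R (ℓ + 1) l.length * (l.map β).prod := by
  have hW : ∀ ℓ (p : Fin (d (ℓ + 2))), ℓ + 1 ≤ L → ∑ q, |W (ℓ + 1) p q| ≤ R (ℓ + 1) :=
    fun ℓ p h => (le_ciSup (f := fun p => ∑ q, |W (ℓ + 1) p q|) (Set.finite_range _).bddAbove
      p).trans (hR (ℓ + 1) (by omega) h)
  have hlen : ∀ l : List ℕ, l ≠ [] → 1 ≤ l.length := fun l h => List.length_pos_iff.2 h
  induction ℓ generalizing l y with
  | zero =>
    have hW0 : ∀ (q : Fin (d 1)) (j : Fin (d 0)), |W 0 q j| ≤ β j := fun q j =>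
      (le_ciSup (f := fun q => |W 0 q j|) (Set.finite_range _).bddAbove q).trans (hβ j)
    simp only [nonperiodicDNN_succ_apply]
    have := abs_listDeriv_layer_le (β := β) (c := fun m => if m = 1 then 1 else 0)
      (g := fun q y => nonperiodicDNN σ W v 0 y q)
      (fun q => contDiff_nonperiodicDNN hσ 0 q)
      (fun q l hl y => by
        simp only [nonperiodicDNN_zero_apply]
        exact abs_listDeriv_affine_le hβ_pos (hW0 q) _ l hl y)
      hσ hA hβ_pos (hW 0 p hℓ) (v 1 p) l hl
      (by rw [compBound_ite_one]; exact (hA_pos _ (hlen l hl)).le) y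
    rwa [compBound_ite_one] at this
  | succ ℓ ih =>
    simp only [nonperiodicDNN_succ_apply (ℓ + 1)]
    have := abs_listDeriv_layer_le (β := β)
      (c := fun m => R (ℓ + 1) * gammaSeq A R (ℓ + 1) m)
      (g := fun q y => nonperiodicDNN σ W v (ℓ + 1) y q)
      (fun q => contDiff_nonperiodicDNN hσ (ℓ + 1) q)
      (fun q l hl y => ih (by omega) q l hl y)
      hσ hA hβ_pos (hW (ℓ + 1) p hℓ) (v (ℓ + 2) p) l hl
      (by
        rw [compBound_mul_gammaSeq A R (hlen l hl)]
        exact gammaSeq_nonneg hA_pos hR_pos _ _ (hlen l hl)) y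
    rwa [compBound_mul_gammaSeq A R (hlen l hl)] at this

lemma abs_mixedPartial_nonperiodicDNN_le {β R A : ℕ → ℝ} {L : ℕ}
    (hβ_pos : ∀ j, 0 < β j) (hR_pos : ∀ ℓ, 1 ≤ ℓ → 0 < R ℓ) (hA_pos : ∀ n, 1 ≤ n → 0 < A n)
    (hβ : ∀ j : Fin (d 0), columnInftyNorm (W 0) j ≤ β j)
    (hR : ∀ ℓ, 1 ≤ ℓ → ℓ ≤ L → matrixInftyNorm (W ℓ) ≤ R ℓ)
    (hσ : ContDiff ℝ ∞ σ) (hA : ∀ n, 1 ≤ n → ∀ x : ℝ, |iteratedDeriv n σ x| ≤ A n)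
    (ℓ : ℕ) (hℓ : 1 ≤ ℓ) (hℓL : ℓ ≤ L) (p : Fin (d (ℓ + 1))) (ν : ℕ →₀ ℕ) (hν : ν ≠ 0)
    (y : Fin (d 0) → ℝ) :
    |mixedPartial ν (fun y => nonperiodicDNN σ W v ℓ y p) y|
      ≤ R ℓ * multiPow β ν * gammaSeq A R ℓ ν.degree := by
  obtain ⟨ℓ, rfl⟩ := Nat.exists_eq_add_of_le' hℓ
  obtain ⟨l, h1, h2, h3⟩ := exists_list_mixedPartial (d 0) β ν
  have hl : l ≠ [] := by
    rintro rfl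
    exact hν ((Finsupp.degree_eq_zero_iff ν).1 h1.symm)
  rw [h3, ← h1, ← h2]
  refine (abs_listDeriv_nonperiodicDNN_le hβ_pos hR_pos hA_pos hβ hR hσ hA ℓ hℓL p l hl
    y).trans_eq ?_
  ring

end Network

/-! ### Sums over multiindices -/

lemma sum_Iic_single_add {M : Type*} [AddCommMonoid M] {a : ℕ} (n : ℕ) {ν : ℕ →₀ ℕ}
    (ha : ν a = 0) (g : (ℕ →₀ ℕ) → M) :
    ∑ m ∈ Finset.Iic (Finsupp.single a n + ν), g m
      = ∑ k ∈ Finset.range (n + 1), ∑ m ∈ Finset.Iic ν, g (Finsupp.single a k + m) := by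
  rw [← Finset.sum_product']
  refine Finset.sum_nbij' (fun m => (m a, m.erase a)) (fun x => Finsupp.single a x.1 + x.2)
    ?_ ?_ ?_ ?_ ?_
  · intro m hm
    rw [Finset.mem_Iic] at hm
    rw [Finset.mem_product, Finset.mem_range, Finset.mem_Iic]
    refine ⟨?_, fun j => ?_⟩
    · have := hm a
      simp [ha] at this
      omega
    · have := hm j
      by_cases hj : j = a
      · simp [hj]
      · simpa [Finsupp.erase_ne hj, Finsupp.single_eq_of_ne hj] using this
  · rintro ⟨k, m⟩ h
    rw [Finset.mem_product, Finset.mem_range, Finset.mem_Iic] at h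
    rw [Finset.mem_Iic]
    exact add_le_add (Finsupp.single_le_single.2 (Nat.lt_succ_iff.1 h.1)) h.2
  · intro m _
    exact Finsupp.single_add_erase a m
  · rintro ⟨k, m⟩ h
    rw [Finset.mem_product, Finset.mem_range, Finset.mem_Iic] at h
    have hm : m a = 0 := Nat.le_zero.1 (ha ▸ h.2 a)
    simp [hm, Finsupp.erase_add]
  · intro m _
    simp only [Finsupp.single_add_erase]

lemma multiStirling_eq_prod {ν m : ℕ →₀ ℕ} {T : Finset ℕ} (h : ν.support ∪ m.support ⊆ T) :
    multiStirling ν m = ∏ j ∈ T, Nat.stirlingSecond (ν j) (m j) := by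
  refine Finset.prod_subset h fun j _ hj => ?_
  rw [Finset.mem_union, not_or, Finsupp.notMem_support_iff, Finsupp.notMem_support_iff] at hj
  rw [hj.1, hj.2, Nat.stirlingSecond_zero]

lemma multiStirling_single_add {a : ℕ} (n k : ℕ) {ν m : ℕ →₀ ℕ} (hν : ν a = 0) (hm : m a = 0) :
    multiStirling (Finsupp.single a n + ν) (Finsupp.single a k + m)
      = Nat.stirlingSecond n k * multiStirling ν m := by
  have ha : a ∉ ν.support ∪ m.support := by simp [hν, hm]
  rw [multiStirling_eq_prod (T := insert a (ν.support ∪ m.support)), Finset.prod_insert ha,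
    multiStirling]
  · congr 1
    · simp [hν, hm]
    · refine Finset.prod_congr rfl fun j hj => ?_
      have hja : j ≠ a := fun h => ha (h ▸ hj)
      simp [Finsupp.single_eq_of_ne hja]
  · intro j hj
    by_cases hja : j = a
    · simp [hja]
    · simpa [Finsupp.single_eq_of_ne hja, hja] using hj

lemma multiStirling_zero_right {ν : ℕ →₀ ℕ} (hν : ν ≠ 0) : multiStirling ν 0 = 0 := by
  obtain ⟨j, hj⟩ := Finsupp.ne_iff.1 hν
  refine Finset.prod_eq_zero (i := j) (by simpa using hj) ?_
  obtain ⟨n, hn⟩ := Nat.exists_eq_succ_of_ne_zero hj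
  rw [hn]
  exact Nat.stirlingSecond_succ_zero n

/-! ### Composition with the sine -/

/-- The coefficient functions `P_{n,k}` of the expansion
`(f (sin 2πx))^(n) = ∑_k P_{n,k}(x) f^(k)(sin 2πx)`. -/
noncomputable def sinCoeff : ℕ → ℕ → ℝ → ℝ
  | 0, 0 => fun _ => 1
  | 0, _ + 1 => fun _ => 0
  | _ + 1, 0 => fun _ => 0
  | n + 1, k + 1 => fun x =>
      deriv (sinCoeff n (k + 1)) x + 2 * Real.pi * Real.cos (2 * Real.pi * x) * sinCoeff n k x

lemma contDiff_two_pi_mul_cos :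
    ContDiff ℝ ∞ (fun x => 2 * Real.pi * Real.cos (2 * Real.pi * x)) :=
  contDiff_const.mul (Real.contDiff_cos.comp (contDiff_const.mul contDiff_id))

lemma contDiff_sinCoeff : ∀ n k, ContDiff ℝ ∞ (sinCoeff n k)
  | 0, 0 => by rw [sinCoeff]; exact contDiff_const
  | 0, _ + 1 => by rw [sinCoeff]; exact contDiff_const
  | _ + 1, 0 => by rw [sinCoeff]; exact contDiff_const
  | n + 1, k + 1 => by
    rw [sinCoeff]
    exact (contDiff_sinCoeff n (k + 1)).deriv_infty.add
      (contDiff_two_pi_mul_cos.mul (contDiff_sinCoeff n k))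

lemma sinCoeff_eq_zero_of_lt : ∀ {n k : ℕ}, n < k → sinCoeff n k = fun _ => 0
  | _, 0, h => by omega
  | 0, k + 1, _ => by rw [sinCoeff]
  | n + 1, k + 1, h => by
    rw [sinCoeff, sinCoeff_eq_zero_of_lt (show n < k + 1 by omega),
      sinCoeff_eq_zero_of_lt (show n < k by omega)]
    simp

lemma deriv_sinCoeff_zero (n : ℕ) (x : ℝ) : deriv (sinCoeff n 0) x = 0 := by
  cases n <;> · rw [sinCoeff]; exact deriv_const _ _

lemma abs_iteratedDeriv_two_pi_mul_cos_le (m : ℕ) (x : ℝ) :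
    |iteratedDeriv m (fun x => 2 * Real.pi * Real.cos (2 * Real.pi * x)) x|
      ≤ (2 * Real.pi) ^ (m + 1) := by
  rw [iteratedDeriv_const_mul_field, iteratedDeriv_comp_const_mul Real.contDiff_cos]
  dsimp only
  rw [← mul_assoc, ← pow_succ', abs_mul, abs_of_pos (pow_pos Real.two_pi_pos _)]
  exact mul_le_of_le_one_right (by positivity) (Real.abs_iteratedDeriv_cos_le_one m _)

/-- `P_{n,k}` behaves like a sum of `S(n, k)` products of `k` trigonometric functions of `2πx`, each
multiplied by `(2π)^n`; this makes the bound on all derivatives consistent with the recursion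
`S(n + 1, k) = k S(n, k) + S(n, k - 1)`. -/
lemma abs_iteratedDeriv_sinCoeff_le (n k m : ℕ) (x : ℝ) :
    |iteratedDeriv m (sinCoeff n k) x|
      ≤ (2 * Real.pi) ^ (n + m) * Nat.stirlingSecond n k * (k : ℝ) ^ m := by
  induction n generalizing k m x with
  | zero =>
    obtain _ | k := k
    · rw [sinCoeff, iteratedDeriv_const]
      obtain _ | m := m <;> simp
    · rw [sinCoeff, iteratedDeriv_const]
      simp
  | succ n ih =>
    obtain _ | k := k
    · rw [sinCoeff, iteratedDeriv_const]
      simp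
    have h1 := contDiff_sinCoeff n (k + 1)
    have h2 := contDiff_sinCoeff n k
    have hm : ((m : ℕ) : WithTop ℕ∞) ≤ ∞ := by exact_mod_cast le_top
    rw [sinCoeff, iteratedDeriv_fun_add (h1.deriv_infty.of_le hm).contDiffAt
      ((contDiff_two_pi_mul_cos.mul h2).of_le hm).contDiffAt, ← iteratedDeriv_succ',
      iteratedDeriv_fun_mul (contDiff_two_pi_mul_cos.of_le hm).contDiffAt (h2.of_le hm).contDiffAt]
    have hsum : |∑ i ∈ Finset.range (m + 1), (m.choose i : ℝ)
          * iteratedDeriv i (fun x => 2 * Real.pi * Real.cos (2 * Real.pi * x)) x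
          * iteratedDeriv (m - i) (sinCoeff n k) x|
        ≤ (2 * Real.pi) ^ (n + m + 1) * Nat.stirlingSecond n k * ((k : ℝ) + 1) ^ m := by
      rw [add_comm (k : ℝ) 1, add_pow, Finset.mul_sum]
      refine (Finset.abs_sum_le_sum_abs _ _).trans (Finset.sum_le_sum fun i hi => ?_)
      rw [abs_mul, abs_mul, Nat.abs_cast]
      calc (m.choose i : ℝ)
            * |iteratedDeriv i (fun x => 2 * Real.pi * Real.cos (2 * Real.pi * x)) x|
            * |iteratedDeriv (m - i) (sinCoeff n k) x|
          ≤ (m.choose i : ℝ) * (2 * Real.pi) ^ (i + 1)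
            * ((2 * Real.pi) ^ (n + (m - i)) * Nat.stirlingSecond n k * (k : ℝ) ^ (m - i)) :=
            mul_le_mul (mul_le_mul_of_nonneg_left (abs_iteratedDeriv_two_pi_mul_cos_le i x)
              (Nat.cast_nonneg _)) (ih k (m - i) x) (abs_nonneg _) (by positivity)
        _ = (2 * Real.pi) ^ (n + m + 1) * Nat.stirlingSecond n k
            * (1 ^ i * (k : ℝ) ^ (m - i) * (m.choose i : ℝ)) := by
            rw [show n + m + 1 = (i + 1) + (n + (m - i)) by
              have := Finset.mem_range.1 hi; omega, pow_add _ (i + 1)]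
            ring
    refine (abs_add_le _ _).trans ((add_le_add (ih (k + 1) (m + 1) x) hsum).trans_eq ?_)
    rw [Nat.stirlingSecond_succ_succ]
    push_cast
    ring

lemma abs_sinCoeff_le (n k : ℕ) (x : ℝ) :
    |sinCoeff n k x| ≤ (2 * Real.pi) ^ n * Nat.stirlingSecond n k := by
  simpa using abs_iteratedDeriv_sinCoeff_le n k 0 x

/-- The componentwise map `y ↦ sin (2πy)`. -/
noncomputable def sinMap {s : ℕ} (y : Fin s → ℝ) : Fin s → ℝ :=
  fun j => Real.sin (2 * Real.pi * y j)

lemma contDiff_sinMap {s : ℕ} : ContDiff ℝ ∞ (sinMap (s := s)) :=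
  contDiff_pi.2 fun j =>
    Real.contDiff_sin.comp (contDiff_const.mul (contDiff_apply ℝ ℝ j))

lemma partialDir_coe {s : ℕ} (a : Fin s) : partialDir s a = Pi.single a 1 := by
  funext i
  simp [partialDir, Pi.single_apply, Fin.ext_iff]

lemma partialDeriv_comp_sinMap {s : ℕ} {f : (Fin s → ℝ) → ℝ} (hf : ContDiff ℝ ∞ f) (a : Fin s) :
    partialDeriv a (fun y => f (sinMap y))
      = fun y => 2 * Real.pi * Real.cos (2 * Real.pi * y a) * partialDeriv a f (sinMap y) := by
  rw [partialDeriv_eq_fderiv (f := fun y => f (sinMap y)) (hf.comp contDiff_sinMap),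
    partialDeriv_eq_fderiv hf]
  funext y
  have hs : HasFDerivAt (sinMap (s := s)) (ContinuousLinearMap.pi fun j =>
      Real.cos (2 * Real.pi * y j) • (2 * Real.pi) • ContinuousLinearMap.proj (R := ℝ) j) y :=
    hasFDerivAt_pi.2 fun j => ((hasFDerivAt_apply j y).const_mul (2 * Real.pi)).sin
  have h := (hf.differentiable (by simp) (sinMap y)).hasFDerivAt.comp y hs
  change fderiv ℝ (f ∘ sinMap) y _ = _
  rw [h.fderiv, ContinuousLinearMap.comp_apply]
  refine Eq.trans ?_ ((fderiv ℝ f (sinMap y)).map_smul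
    (2 * Real.pi * Real.cos (2 * Real.pi * y a)) (partialDir s a))
  congr 1
  funext i
  by_cases hi : i = a
  · subst hi
    simp [partialDir_coe, mul_comm]
  · simp [partialDir_coe, hi]

lemma partialDeriv_coord {s : ℕ} {c : ℝ → ℝ} (hc : ContDiff ℝ ∞ c) (a : Fin s) :
    partialDeriv a (fun y : Fin s → ℝ => c (y a)) = fun y => deriv c (y a) := by
  rw [partialDeriv_comp hc (contDiff_apply ℝ ℝ a), partialDeriv_eq_fderiv (contDiff_apply ℝ ℝ a)]
  funext y
  have := (hasFDerivAt_apply (𝕜 := ℝ) a y).fderiv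
  simp only [this, partialDir_coe]
  simp

lemma iterate_partialDeriv_comp_sinMap {s : ℕ} {f : (Fin s → ℝ) → ℝ} (hf : ContDiff ℝ ∞ f)
    (a : Fin s) (n : ℕ) :
    (partialDeriv a)^[n] (fun y => f (sinMap y))
      = fun y => ∑ k ∈ Finset.range (n + 1),
        sinCoeff n k (y a) * (partialDeriv a)^[k] f (sinMap y) := by
  induction n with
  | zero =>
    funext y
    simp [sinCoeff]
  | succ n ih =>
    have hF : ∀ k, ContDiff ℝ ∞ (fun y => (partialDeriv a)^[k] f (sinMap y)) := fun k =>
      (hf.iterate_partialDeriv a k).comp contDiff_sinMap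
    have hP : ∀ k, ContDiff ℝ ∞ (fun y : Fin s → ℝ => sinCoeff n k (y a)) := fun k =>
      (contDiff_sinCoeff n k).comp (contDiff_apply ℝ ℝ a)
    have hsum := partialDeriv_sum_mul (Finset.range (n + 1)) (fun _ => 1)
      (fun k => (hP k).mul (hF k)) a
    simp only [one_mul] at hsum
    rw [Function.iterate_succ_apply', ih, hsum]
    funext y
    have hterm : ∀ k, partialDeriv a
        (fun y => sinCoeff n k (y a) * (partialDeriv a)^[k] f (sinMap y)) y
        = deriv (sinCoeff n k) (y a) * (partialDeriv a)^[k] f (sinMap y)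
          + 2 * Real.pi * Real.cos (2 * Real.pi * y a) * sinCoeff n k (y a)
            * (partialDeriv a)^[k + 1] f (sinMap y) := by
      intro k
      rw [partialDeriv_mul (hP k) (hF k), partialDeriv_coord (contDiff_sinCoeff n k),
        partialDeriv_comp_sinMap (hf.iterate_partialDeriv a k), Function.iterate_succ_apply']
      ring
    simp only [hterm, Finset.sum_add_distrib]
    -- Both end terms of `∑ k ≤ n + 1, P_{n,k}' ∂^k f` vanish, so the index can be shifted by one.
    have hshift : ∑ k ∈ Finset.range (n + 1),
          deriv (sinCoeff n k) (y a) * (partialDeriv a)^[k] f (sinMap y)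
        = ∑ k ∈ Finset.range (n + 1),
          deriv (sinCoeff n (k + 1)) (y a) * (partialDeriv a)^[k + 1] f (sinMap y) := by
      have h1 := Finset.sum_range_succ
        (fun k => deriv (sinCoeff n k) (y a) * (partialDeriv a)^[k] f (sinMap y)) (n + 1)
      have h2 := Finset.sum_range_succ'
        (fun k => deriv (sinCoeff n k) (y a) * (partialDeriv a)^[k] f (sinMap y)) (n + 1)
      rw [sinCoeff_eq_zero_of_lt (Nat.lt_succ_self n), deriv_const, zero_mul, add_zero] at h1
      rw [deriv_sinCoeff_zero, zero_mul, add_zero] at h2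
      exact h1.symm.trans h2
    rw [hshift, Finset.sum_range_succ' _ (n + 1), ← Finset.sum_add_distrib]
    simp only [sinCoeff, zero_mul, add_zero, add_mul]

lemma mixedPartial_sum_coord_mul {s : ℕ} {ι : Type*} (t : Finset ι) (a : Fin s) {ν : ℕ →₀ ℕ}
    (hν : ν a = 0) (c : ι → ℝ → ℝ) {f : ι → (Fin s → ℝ) → ℝ} (hf : ∀ i, ContDiff ℝ ∞ (f i)) :
    mixedPartial ν (fun y => ∑ i ∈ t, c i (y a) * f i y)
      = fun y => ∑ i ∈ t, c i (y a) * mixedPartial ν (f i) y := by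
  induction ν using Finsupp.induction_on_max generalizing f with
  | zero => simp only [mixedPartial_zero]
  | single_add b n ν h hn ih =>
    have hb : (a : ℕ) ≠ b := by
      rintro rfl
      simp [hn] at hν
    have hν' : ν a = 0 := by simpa [Finsupp.single_eq_of_ne hb] using hν
    simp only [mixedPartial_single_add n h]
    rw [iterate_partialDeriv_sum_coord_mul t a c hf hb n,
      ih hν' fun i => (hf i).iterate_partialDeriv b n]

lemma iterate_partialDeriv_of_le {s j n : ℕ} (hj : s ≤ j) (hn : n ≠ 0) (f : (Fin s → ℝ) → ℝ) :
    (partialDeriv j)^[n] f = fun _ => 0 := by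
  obtain ⟨n, rfl⟩ := Nat.exists_eq_succ_of_ne_zero hn
  rw [Function.iterate_succ_apply']
  funext y
  have : (fun i : Fin s => if (i : ℕ) = j then (1 : ℝ) else 0) = 0 := by
    funext i
    exact if_neg (by have := i.2; omega)
  rw [partialDeriv, this, lineDeriv_zero]

lemma mixedPartial_fun_zero {s : ℕ} (ν : ℕ →₀ ℕ) :
    mixedPartial ν (fun _ : Fin s → ℝ => 0) = fun _ => 0 := by
  obtain ⟨l, -, -, h⟩ := exists_list_mixedPartial s 0 ν
  rw [h]
  by_cases hl : l = []
  · rw [hl]; rfl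
  · exact listDeriv_const hl 0

/-- The multivariate Faà di Bruno formula for the componentwise inner function `sin (2πy)`, as an
inequality. -/
lemma abs_mixedPartial_comp_sinMap_le {s : ℕ} (ν : ℕ →₀ ℕ) {f : (Fin s → ℝ) → ℝ}
    (hf : ContDiff ℝ ∞ f) (y : Fin s → ℝ) :
    |mixedPartial ν (fun y => f (sinMap y)) y|
      ≤ (2 * Real.pi) ^ ν.degree
        * ∑ m ∈ Finset.Iic ν, |mixedPartial m f (sinMap y)| * (multiStirling ν m : ℝ) := by
  induction ν using Finsupp.induction_on_max generalizing f with
  | zero =>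
    have : Finset.Iic (0 : ℕ →₀ ℕ) = {0} := by
      ext m
      simp
    simp [this, mixedPartial_zero, multiStirling]
  | single_add a n ν h hn ih =>
    obtain ha | ha := le_or_gt s a
    · rw [mixedPartial_single_add n h, iterate_partialDeriv_of_le ha hn, mixedPartial_fun_zero,
        abs_zero]
      have := Real.two_pi_pos
      positivity
    lift a to Fin s using ha
    have hνa : ν a = 0 := Finsupp.notMem_support_iff.1 fun h' => (h a h').ne rfl
    have hF : ∀ k, ContDiff ℝ ∞ (fun y => (partialDeriv a)^[k] f (sinMap y)) := fun k =>
      (hf.iterate_partialDeriv a k).comp contDiff_sinMap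
    rw [mixedPartial_single_add n h, iterate_partialDeriv_comp_sinMap hf,
      mixedPartial_sum_coord_mul _ a hνa (sinCoeff n) hF, sum_Iic_single_add n hνa,
      map_add, Finsupp.degree_single, Finset.mul_sum]
    refine (Finset.abs_sum_le_sum_abs _ _).trans (Finset.sum_le_sum fun k _ => ?_)
    rw [abs_mul]
    refine (mul_le_mul (abs_sinCoeff_le n k (y a)) (ih (hf.iterate_partialDeriv a k))
      (abs_nonneg _) (by have := Real.two_pi_pos; positivity)).trans_eq ?_
    rw [pow_add, Finset.mul_sum, Finset.mul_sum, Finset.mul_sum]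
    refine Finset.sum_congr rfl fun m hm => ?_
    rw [Finset.mem_Iic] at hm
    have hm' : ∀ c ∈ m.support, c < (a : ℕ) := fun c hc => h c (Finsupp.support_mono hm hc)
    have hma : m a = 0 := Nat.le_zero.1 (hνa ▸ hm a)
    rw [multiStirling_single_add n k hνa hma, mixedPartial_single_add k hm']
    push_cast
    ring

/-! ### The periodic network -/

lemma periodicDNN_eq_nonperiodicDNN_sinMap (σ : ℝ → ℝ) {d : ℕ → ℕ}
    (W : (ℓ : ℕ) → Matrix (Fin (d (ℓ + 1))) (Fin (d ℓ)) ℝ) (v : (ℓ : ℕ) → Fin (d (ℓ + 1)) → ℝ)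
    (ℓ : ℕ) (y : Fin (d 0) → ℝ) :
    periodicDNN σ W v ℓ y = nonperiodicDNN σ W v ℓ (sinMap y) := by
  induction ℓ with
  | zero => rw [periodicDNN, nonperiodicDNN]; rfl
  | succ ℓ ih => rw [periodicDNN, nonperiodicDNN, ih]

/-- Regularity bounds for non-periodic and periodic deep neural networks. -/
theorem mainTheorem1
    (L : ℕ) (d : ℕ → ℕ)
    (W : (ℓ : ℕ) → Matrix (Fin (d (ℓ + 1))) (Fin (d ℓ)) ℝ)
    (v : (ℓ : ℕ) → Fin (d (ℓ + 1)) → ℝ)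
    (σ : ℝ → ℝ) (β R A : ℕ → ℝ)
    (hβ_pos : ∀ j, 0 < β j)
    (hR_pos : ∀ ℓ, 1 ≤ ℓ → 0 < R ℓ)
    (hA_pos : ∀ n, 1 ≤ n → 0 < A n)
    (hβ : ∀ j : Fin (d 0), columnInftyNorm (W 0) j ≤ β j)
    (hR : ∀ ℓ, 1 ≤ ℓ → ℓ ≤ L → matrixInftyNorm (W ℓ) ≤ R ℓ)
    (hσ : ContDiff ℝ ∞ σ)
    (hA : ∀ n, 1 ≤ n → ∀ x : ℝ, |iteratedDeriv n σ x| ≤ A n)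
    (ℓ : ℕ) (hℓ : 1 ≤ ℓ) (hℓL : ℓ ≤ L) (p : Fin (d (ℓ + 1))) :
    (ContDiff ℝ ∞ (fun y => nonperiodicDNN σ W v ℓ y p) ∧
      ∀ ν : ℕ →₀ ℕ, ν ≠ 0 → ∀ y : Fin (d 0) → ℝ,
        |mixedPartial ν (fun y => nonperiodicDNN σ W v ℓ y p) y|
          ≤ R ℓ * multiPow β ν * gammaSeq A R ℓ ν.degree) ∧
    (ContDiff ℝ ∞ (fun y => periodicDNN σ W v ℓ y p) ∧
      ∀ ν : ℕ →₀ ℕ, ν ≠ 0 → ∀ y : Fin (d 0) → ℝ,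
        |mixedPartial ν (fun y => periodicDNN σ W v ℓ y p) y|
          ≤ R ℓ * (2 * Real.pi) ^ ν.degree *
            ∑ m ∈ Finset.Iic ν,
              multiPow β m * gammaSeq A R ℓ m.degree * (multiStirling ν m : ℝ)) := by
  have hsmooth := contDiff_nonperiodicDNN (W := W) (v := v) hσ ℓ p
  have hbound := abs_mixedPartial_nonperiodicDNN_le (v := v) hβ_pos hR_pos hA_pos hβ hR hσ hA
    ℓ hℓ hℓL p
  refine ⟨⟨hsmooth, hbound⟩, ?_⟩
  simp only [periodicDNN_eq_nonperiodicDNN_sinMap]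
  refine ⟨hsmooth.comp contDiff_sinMap, fun ν hν y => ?_⟩
  refine (abs_mixedPartial_comp_sinMap_le ν hsmooth y).trans ?_
  rw [mul_comm (R ℓ), mul_assoc, Finset.mul_sum _ _ (R ℓ)]
  refine mul_le_mul_of_nonneg_left (Finset.sum_le_sum fun m _ => ?_)
    (pow_nonneg Real.two_pi_pos.le _)
  obtain rfl | hm := eq_or_ne m 0
  · simp [multiStirling_zero_right hν]
  · rw [← mul_assoc, ← mul_assoc]
    exact mul_le_mul_of_nonneg_right (hbound m hm _) (Nat.cast_nonneg _)
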